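/- For an element $q$ of a commutative topological ring write $(a;q)_m=\prod_{j=0}^{m-1}(1-aq^j)$, $(a;q)_\infty=\prod_{j=0}^{\infty}(1-aq^j)$ and $(a_1,a_2,a_3;q)_\infty=(a_1;q)_\infty(a_2;q)_\infty(a_3;q)_\infty$. Then $$\sum_{n,r\ge 0}\frac{q^{2n^2+4nr+3r^2}}{(-q;q)_{n+r}\,(-q;q)_{n+2r}\,(q;q)_n\,(q;q)_r}=\frac{(q^4,q^5,q^9;q^9)_\infty}{(q^2;q^2)_\infty}$$ holds in each of the following two settings. (1) For every complex number $q$ with $|q|<1$: the infinite products converge, all denominators are nonzero, and the double series converges unconditionally to the right-hand side. (2) As an identity of formal power series in the indeterminate $q$ over any commutative ring $R$: in $R[[q]]$ with the topology of coefficientwise convergence ($R$ discrete), the infinite products converge, all denominators are invertible, and the double series converges unconditionally to the right-hand side. -/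

import Mathlib

open scoped PowerSeries PowerSeries.WithPiTopology

/-- The finite `q`-shifted factorial `(a; q)_m = ∏_{j=0}^{m-1} (1 - a q^j)`. -/
def qPoch {R : Type*} [CommRing R] (a q : R) (m : ℕ) : R :=
  ∏ j ∈ Finset.range m, (1 - a * q ^ j)

/-- The infinite `q`-shifted factorial `(a; q)_∞ = ∏_{j=0}^∞ (1 - a q^j)`
(meaningful when the product converges, see `QPochConverges`). -/
noncomputable def qPochInf {R : Type*} [CommRing R] [TopologicalSpace R] (a q : R) : R :=
  ∏' j : ℕ, (1 - a * q ^ j)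

/-- Convergence of the infinite product `(a; q)_∞`. -/
def QPochConverges {R : Type*} [CommRing R] [TopologicalSpace R] (a q : R) : Prop :=
  Multipliable fun j : ℕ => 1 - a * q ^ j

/-- `(a₁, a₂, a₃; q)_∞ = (a₁; q)_∞ (a₂; q)_∞ (a₃; q)_∞`. -/
noncomputable def qPochInf₃ {R : Type*} [CommRing R] [TopologicalSpace R] (a₁ a₂ a₃ q : R) : R :=
  qPochInf a₁ q * qPochInf a₂ q * qPochInf a₃ q

/-- The denominator `(-q; q)_{n+r} (-q; q)_{n+2r} (q; q)_n (q; q)_r` of the `(n, r)` summand. -/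
def summandDenom {R : Type*} [CommRing R] (q : R) (n r : ℕ) : R :=
  qPoch (-q) q (n + r) * qPoch (-q) q (n + 2 * r) * qPoch q q n * qPoch q q r

/-! ### Finite `q`-series identities over an arbitrary commutative ring -/

section FiniteIdentities

variable {A : Type*} [CommRing A]

/-! The proof is a Bailey-pair argument. With `N = n + r` the exponent is `2N² + r²`, so the double
series is `∑ q^(2N²) β_N` with `β_N = ∑_r q^(r²) / ((q)_r (q)_(N-r) (-q)_N (-q)_(N+r))`. By
`sum_baileyPair`, `β_N = ∑_n α_n / ((q²;q²)_(N-n) (q²;q²)_(N+n))`, where `α_n` is `(-1)^n q^(2n² +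
n(n-1)/2)` times the weight `1 + q^n` (`1` at `n = 0`). The Bailey lemma in base `q²` then turns the
series into `∑ q^(2n²) α_n / (q²;q²)_∞`, and this numerator is the folded theta series `∑_ℤ (-1)^n
q^((9n²-n)/2)`, a product of modulus `9` by Jacobi's triple product.

The pair itself comes from two steps in base `q`: `sum_sixPhiFive` at `x = -q^N` expands `1 / ((q)_r
(xq)_r)`, and `sum_baileyKernel` sums over `r`. The factors `(-q)_(N±n)` left over merge with
`(q)_(N±n)` into base `q²`.

All of this is done first as exact finite identities (`sum_doubleSum_finite`,
`sum_theta_nine_finite`), valid whenever the factors `1 ± q^j` that occur are units. Only then does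
`M → ∞`, through `QLimitPrinciples`, an interface satisfied both by complex numbers and by power
series. -/

lemma qPoch_zero (a q : A) : qPoch a q 0 = 1 := by simp [qPoch]

lemma qPoch_succ (a q : A) (m : ℕ) : qPoch a q (m + 1) = qPoch a q m * (1 - a * q ^ m) := by
  simp [qPoch, Finset.prod_range_succ]

lemma qPoch_add (a q : A) (m n : ℕ) :
    qPoch a q (m + n) = qPoch a q m * qPoch (a * q ^ m) q n := by
  simp only [qPoch, Finset.prod_range_add]
  congr 1
  exact Finset.prod_congr rfl fun j _ => by ring

lemma isUnit_qPoch {a q : A} (h : ∀ j : ℕ, IsUnit (1 - a * q ^ j)) (m : ℕ) :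
    IsUnit (qPoch a q m) := by
  induction m with
  | zero => simp [qPoch_zero]
  | succ m ih => rw [qPoch_succ]; exact ih.mul (h m)

/-- The inverse `1 / (a; q)_m`, extended by zero to negative `m`. -/
noncomputable def qPochInv (a q : A) (m : ℤ) : A :=
  if 0 ≤ m then Ring.inverse (qPoch a q m.toNat) else 0

lemma qPochInv_natCast (a q : A) (m : ℕ) :
    qPochInv a q m = Ring.inverse (qPoch a q m) := by simp [qPochInv]

lemma qPochInv_of_neg (a q : A) {m : ℤ} (hm : m < 0) : qPochInv a q m = 0 := by
  simp [qPochInv, not_le.2 hm]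

lemma qPochInv_zero (a q : A) : qPochInv a q 0 = 1 := by simp [qPochInv, qPoch_zero]

lemma qPoch_mul_qPochInv {a q : A} (h : ∀ j : ℕ, IsUnit (1 - a * q ^ j)) (m : ℕ) :
    qPoch a q m * qPochInv a q m = 1 := by
  rw [qPochInv_natCast, Ring.mul_inverse_cancel _ (isUnit_qPoch h m)]

lemma qPochInv_nat {a q : A} (h : ∀ j : ℕ, IsUnit (1 - a * q ^ j)) (m : ℕ) :
    qPochInv a q m = (1 - a * q ^ m) * qPochInv a q (m + 1 : ℕ) := by
  apply (isUnit_qPoch h m).mul_left_cancel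
  rw [qPoch_mul_qPochInv h, ← mul_assoc, ← qPoch_succ, qPoch_mul_qPochInv h]

/-- The extension by zero is consistent with the recurrence at `m = 0` because `1 - q^0 = 0`. Hence
`q`-Pascal arguments need no separate boundary cases. -/
lemma qPochInv_sub_one {q : A} (h : ∀ j : ℕ, IsUnit (1 - q * q ^ j)) (m : ℤ) :
    qPochInv q q (m - 1) = (1 - q ^ m.toNat) * qPochInv q q m := by
  rcases lt_trichotomy m 0 with hm | rfl | hm
  · rw [qPochInv_of_neg _ _ hm, qPochInv_of_neg _ _ (by lia), mul_zero]
  · simp [qPochInv_of_neg]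
  · obtain ⟨k, rfl⟩ : ∃ k : ℕ, m = (k + 1 : ℕ) := ⟨(m - 1).toNat, by lia⟩
    have e : ((k + 1 : ℕ) : ℤ) - 1 = k := by push_cast; ring
    rw [e, qPochInv_nat h, Int.toNat_natCast, pow_succ']

/-- A limiting case of the `q`-Chu--Vandermonde sum. -/
lemma sum_qVandermonde {q : A} (h : ∀ j : ℕ, IsUnit (1 - q * q ^ j)) (M s : ℕ) :
    ∑ k ∈ Finset.range (M + 1), q ^ (k * (k + s)) *
      (qPochInv q q (M - k) * qPochInv q q k * qPochInv q q (k + s)) =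
    qPochInv q q M * qPochInv q q (M + s) := by
  induction M generalizing s with
  | zero => simp [qPochInv_zero]
  | succ M ih =>
    have hM := h M
    rw [← pow_succ'] at hM
    apply hM.mul_left_cancel
    -- `q`-Pascal: `1 - q^(M+1) = (1 - q^(M+1-k)) + q^(M+1-k) (1 - q^k)`. The first part gives the
    -- sum for `(M, s)`; the second, after `k ↦ k + 1`, gives `q^(M+1+s)` times the sum for `(M, s +
    -- 1)`.
    have key : ∀ k ∈ Finset.range (M + 1 + 1), (1 - q ^ (M + 1)) * (q ^ (k * (k + s)) *
        (qPochInv q q ((M + 1 : ℕ) - k) * qPochInv q q k * qPochInv q q (k + s))) =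
        q ^ (k * (k + s)) *
          (qPochInv q q (M - k) * qPochInv q q k * qPochInv q q (k + s)) +
        q ^ (M + 1 - k) * q ^ (k * (k + s)) *
          (qPochInv q q ((M + 1 : ℕ) - k) * qPochInv q q (k - 1) * qPochInv q q (k + s)) := by
      intro k hk
      obtain ⟨t, ht⟩ := Nat.exists_eq_add_of_le (Finset.mem_range_succ_iff.1 hk)
      have h1 := qPochInv_sub_one h ((M + 1 : ℕ) - k)
      have h2 := qPochInv_sub_one h k
      have e1 : (((M + 1 : ℕ) : ℤ) - k).toNat = t := by lia
      have e2 : (((M + 1 : ℕ) : ℤ) - k - 1) = M - k := by push_cast; ring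
      have e3 : M + 1 - k = t := by lia
      rw [e1, e2] at h1
      rw [Int.toNat_natCast] at h2
      rw [h1, h2, e3, ht]
      ring
    rw [Finset.mul_sum, Finset.sum_congr rfl key, Finset.sum_add_distrib, Finset.sum_range_succ,
      ih, Finset.sum_range_succ' (n := M + 1)]
    have h0 : ∀ k ∈ Finset.range (M + 1), q ^ (M + 1 - (k + 1)) * q ^ ((k + 1) * (k + 1 + s)) *
          (qPochInv q q ((M + 1 : ℕ) - (k + 1 : ℕ)) * qPochInv q q ((k + 1 : ℕ) - 1) *
            qPochInv q q ((k + 1 : ℕ) + s)) =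
        q ^ (M + 1 + s) * (q ^ (k * (k + (s + 1))) *
          (qPochInv q q (M - k) * qPochInv q q k * qPochInv q q (k + (s + 1 : ℕ)))) := by
      intro k hk
      obtain ⟨t, rfl⟩ := Nat.exists_eq_add_of_le (Finset.mem_range_succ_iff.1 hk)
      have e1 : k + t + 1 - (k + 1) = t := by lia
      have e2 : (((k + t + 1 : ℕ) : ℤ) - (k + 1 : ℕ)) = (k + t : ℕ) - k := by push_cast; ring
      have e3 : ((k + 1 : ℕ) : ℤ) - 1 = k := by push_cast; ring
      have e4 : ((k + 1 : ℕ) : ℤ) + s = k + (s + 1 : ℕ) := by push_cast; ring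
      rw [e1, e2, e3, e4]
      ring
    rw [Finset.sum_congr rfl h0, ← Finset.mul_sum, ih]
    have h1 := qPochInv_sub_one h (M + 1 : ℕ)
    have h2 := qPochInv_sub_one h (M + 1 + s : ℕ)
    rw [Int.toNat_natCast] at h1 h2
    have e1 : ((M + 1 : ℕ) : ℤ) - 1 = M := by push_cast; ring
    have e2 : ((M + 1 + s : ℕ) : ℤ) - 1 = M + s := by push_cast; ring
    have e3 : (M : ℤ) + (s + 1 : ℕ) = (M + 1 + s : ℕ) := by push_cast; ring
    have e4 : ((M + 1 : ℕ) : ℤ) + s = (M + 1 + s : ℕ) := by push_cast; ring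
    have e5 : (M : ℤ) - (M + 1 : ℕ) = -1 := by push_cast; ring
    rw [e1] at h1
    rw [e2] at h2
    rw [e3, e4, e5, qPochInv_of_neg q q (m := -1) (by lia), h2, h1]
    simp [qPochInv_of_neg]
    ring

/-- The limiting case `ρ₁, ρ₂ → ∞` of the Bailey lemma, on the level of kernels. -/
lemma sum_baileyKernel {q : A} (h : ∀ j : ℕ, IsUnit (1 - q * q ^ j)) (N n : ℕ) :
    ∑ r ∈ Finset.range (N + 1), q ^ r ^ 2 *
      (qPochInv q q (N - r) * (qPochInv q q (r - n) * qPochInv q q (r + n))) =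
    q ^ n ^ 2 * (qPochInv q q (N - n) * qPochInv q q (N + n)) := by
  by_cases hn : n ≤ N
  · obtain ⟨M, rfl⟩ := Nat.exists_eq_add_of_le hn
    -- Terms with `r < n` vanish; `r = n + k` leaves the Vandermonde sum with shift `s = 2n`.
    rw [add_assoc, Finset.sum_range_add, Finset.sum_eq_zero, zero_add]
    · have e1 : ((n + M : ℕ) : ℤ) - n = M := by push_cast; ring
      have e2 : ((n + M : ℕ) : ℤ) + n = M + (2 * n : ℕ) := by push_cast; ring
      rw [e1, e2, ← sum_qVandermonde h M (2 * n), Finset.mul_sum]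
      refine Finset.sum_congr rfl fun k _ => ?_
      have e1 : ((n + M : ℕ) : ℤ) - (n + k : ℕ) = M - k := by push_cast; ring
      have e2 : ((n + k : ℕ) : ℤ) + n = k + (2 * n : ℕ) := by push_cast; ring
      have e3 : ((n + k : ℕ) : ℤ) - n = k := by push_cast; ring
      rw [e1, e2, e3]
      ring
    · intro r hr
      have := Finset.mem_range.1 hr
      rw [qPochInv_of_neg q q (m := (r : ℤ) - n) (by lia)]
      ring
  · rw [qPochInv_of_neg q q (m := (N : ℤ) - n) (by lia), Finset.sum_eq_zero]
    · ring
    · intro r hr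
      have := Finset.mem_range.1 hr
      rw [qPochInv_of_neg q q (m := (r : ℤ) - n) (by lia)]
      ring

/-- The weight that folds a bilateral sum into a unilateral one. -/
def foldWeight (q : A) (n : ℕ) : A := if n = 0 then 1 else 1 + q ^ n

/-- A limiting case of Rogers' `₆φ₅` sum: the Bailey pair with `β_r = 1 / ((q; q)_r (xq; q)_r)`. -/
lemma sum_sixPhiFive {q x : A} (h : ∀ j : ℕ, IsUnit (1 - q * q ^ j))
    (hx : ∀ j : ℕ, IsUnit (1 - x * q * q ^ j)) (r : ℕ) :
    ∑ n ∈ Finset.range (r + 1), foldWeight q n * q ^ n ^ 2 *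
      (∏ j ∈ Finset.range n, (x - q ^ j)) * qPochInv (x * q) q n *
        (qPochInv q q (r - n) * qPochInv q q (r + n)) =
      qPochInv q q r * qPochInv (x * q) q r := by
  induction r with
  | zero => simp [qPochInv_zero, foldWeight]
  | succ r ih =>
    set F : ℕ → ℕ → A := fun r n => foldWeight q n * q ^ n ^ 2 *
      (∏ j ∈ Finset.range n, (x - q ^ j)) * qPochInv (x * q) q n *
        (qPochInv q q (r - n) * qPochInv q q (r + n)) with hF
    -- A WZ-style certificate: the recurrence in `r` satisfied by the right side holds for the
    -- summands up to a telescoping term, which vanishes at `k = r + 1` because `1 / (q)_(-1) = 0`.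
    have tele : ∀ k ≤ r + 1, ∑ n ∈ Finset.range (k + 1),
        ((1 - q ^ (r + 1)) * (1 - x * q ^ (r + 1)) * F (r + 1) n - F r n) =
        -(q ^ (r + 1 + k + k ^ 2) * (∏ j ∈ Finset.range (k + 1), (x - q ^ j)) *
          qPochInv (x * q) q k * (qPochInv q q (r - k) * qPochInv q q ((r + 1 : ℕ) + k))) := by
      intro k hk
      induction k with
      | zero =>
        have h1 := qPochInv_sub_one h (r + 1 : ℕ)
        have e1 : ((r + 1 : ℕ) : ℤ) - 1 = r := by push_cast; ring
        rw [Int.toNat_natCast, e1] at h1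
        simp only [hF, foldWeight, Finset.sum_range_one, zero_add, Finset.prod_range_zero,
          Finset.prod_range_one, Nat.cast_zero, sub_zero, add_zero, if_true, h1, qPochInv_zero]
        ring
      | succ k ihk =>
        obtain ⟨t, ht⟩ := Nat.exists_eq_add_of_le hk
        obtain rfl : r = k + t := by lia
        rw [Finset.sum_range_succ, ihk (by lia), Finset.prod_range_succ _ (k + 1)]
        have h1 := qPochInv_sub_one h t
        have h2 := qPochInv_sub_one h (k + t + 1 + (k + 1) : ℕ)
        have h3 := qPochInv_nat hx k
        have e1 : ((k + t + 1 + (k + 1) : ℕ) : ℤ) - 1 = (k + t + 1 : ℕ) + k := by push_cast; ring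
        rw [Int.toNat_natCast] at h1 h2
        rw [e1] at h2
        have e2 : ((k + t : ℕ) : ℤ) - k = t := by push_cast; ring
        have e3 : ((k + t : ℕ) : ℤ) - (k + 1 : ℕ) = t - 1 := by push_cast; ring
        have e4 : ((k + t + 1 : ℕ) : ℤ) - (k + 1 : ℕ) = t := by push_cast; ring
        have e5 : ((k + t + 1 : ℕ) : ℤ) + (k + 1 : ℕ) = (k + t + 1 + (k + 1) : ℕ) := by
          push_cast; ring
        have e6 : ((k + t : ℕ) : ℤ) + (k + 1 : ℕ) = (k + t + 1 : ℕ) + k := by push_cast; ring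
        simp only [hF, foldWeight, e2, e3, e4, e5, e6, h1, h2, h3, Nat.succ_ne_zero, if_false]
        ring
    have htot := tele (r + 1) le_rfl
    rw [qPochInv_of_neg q q (m := (r : ℤ) - (r + 1 : ℕ)) (by lia), Finset.sum_sub_distrib,
      ← Finset.mul_sum, Finset.sum_range_succ (fun n => F r n)] at htot
    have hlast : F r (r + 1) = 0 := by
      simp only [hF]
      rw [qPochInv_of_neg q q (m := (r : ℤ) - (r + 1 : ℕ)) (by lia)]
      ring
    have hu := (h r).mul (hx r)
    rw [mul_assoc x, ← pow_succ'] at hu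
    apply hu.mul_left_cancel
    have h1 := qPochInv_nat h r
    have h2 := qPochInv_nat hx r
    rw [← pow_succ'] at h1
    rw [mul_assoc x, ← pow_succ'] at h2
    have h3 : ∑ n ∈ Finset.range (r + 1), F r n = qPochInv q q r * qPochInv (x * q) q r := ih
    rw [hlast, h3, h1, h2] at htot
    linear_combination htot

end FiniteIdentities

/-! ### The Bailey pair in base `q²` and the finite double-sum identity -/

section BaileyPair

variable {A : Type*} [CommRing A]

lemma isUnit_one_sub_sq {q : A} (h : ∀ j : ℕ, IsUnit (1 - q * q ^ j))
    (h' : ∀ j : ℕ, IsUnit (1 - -q * q ^ j)) (j : ℕ) : IsUnit (1 - q ^ 2 * (q ^ 2) ^ j) := by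
  convert (h j).mul (h' j) using 1
  ring

lemma qPochInv_sq {q : A} (h : ∀ j : ℕ, IsUnit (1 - q * q ^ j))
    (h' : ∀ j : ℕ, IsUnit (1 - -q * q ^ j)) (m : ℤ) :
    qPochInv (q ^ 2) (q ^ 2) m = qPochInv q q m * qPochInv (-q) q m := by
  rcases lt_or_ge m 0 with hm | hm
  · simp [qPochInv_of_neg _ _ hm]
  · lift m to ℕ using hm
    apply (isUnit_qPoch (isUnit_one_sub_sq h h') m).mul_left_cancel
    have e : qPoch (q ^ 2) (q ^ 2) m = qPoch q q m * qPoch (-q) q m := by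
      simp only [qPoch, ← Finset.prod_mul_distrib]
      exact Finset.prod_congr rfl fun j _ => by ring
    rw [qPoch_mul_qPochInv (isUnit_one_sub_sq h h'), e]
    linear_combination (-(qPoch (-q) q m * qPochInv (-q) q m)) * qPoch_mul_qPochInv h m -
      qPoch_mul_qPochInv h' m

/-- Each factor is `-q^j (1 + q^(N-j))`. This evaluates the numerator of `sum_sixPhiFive` at `x =
-q^N`. -/
lemma prod_neg_pow_sub_pow {q : A} (h' : ∀ j : ℕ, IsUnit (1 - -q * q ^ j)) {N n : ℕ}
    (hn : n ≤ N) :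
    ∏ j ∈ Finset.range n, (-q ^ N - q ^ j) =
      (-1) ^ n * q ^ (n.choose 2) * (qPoch (-q) q N * qPochInv (-q) q (N - n)) := by
  induction n with
  | zero => simp [qPoch_mul_qPochInv h']
  | succ n ih =>
    obtain ⟨t, rfl⟩ := Nat.exists_eq_add_of_le hn
    have h1 := qPochInv_nat h' t
    have e1 : ((n + 1 + t : ℕ) : ℤ) - n = (t + 1 : ℕ) := by push_cast; ring
    have e2 : ((n + 1 + t : ℕ) : ℤ) - (n + 1 : ℕ) = t := by push_cast; ring
    have e3 : (n + 1).choose 2 = n + n.choose 2 := by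
      rw [Nat.choose_succ_succ' n 1, Nat.choose_one_right]
    rw [Finset.prod_range_succ, ih (by lia), e1, e2, e3, h1]
    ring

/-- The Bailey pair (relative to `a = 1`, base `q ^ 2`) behind the double sum. -/
lemma sum_baileyPair {q : A} (h : ∀ j : ℕ, IsUnit (1 - q * q ^ j))
    (h' : ∀ j : ℕ, IsUnit (1 - -q * q ^ j)) (N : ℕ) :
    ∑ r ∈ Finset.range (N + 1), q ^ r ^ 2 * (qPochInv q q r * qPochInv q q (N - r) *
      qPochInv (-q) q N * qPochInv (-q) q (N + r)) =
    ∑ n ∈ Finset.range (N + 1), foldWeight q n * (-1) ^ n * q ^ (2 * n ^ 2 + n.choose 2) *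
      (qPochInv (q ^ 2) (q ^ 2) (N - n) * qPochInv (q ^ 2) (q ^ 2) (N + n)) := by
  have hx : ∀ j : ℕ, IsUnit (1 - -q ^ N * q * q ^ j) := fun j => by
    convert h' (N + j) using 1; ring
  have hd : ∀ r : ℕ, qPochInv (-q ^ N * q) q r = qPoch (-q) q N * qPochInv (-q) q (N + r) := by
    intro r
    apply (isUnit_qPoch hx r).mul_left_cancel
    have e := qPoch_add (-q) q N r
    have e' : -q * q ^ N = -q ^ N * q := by ring
    rw [e'] at e
    rw [qPoch_mul_qPochInv hx, ← Nat.cast_add, ← qPoch_mul_qPochInv h' (N + r), e]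
    ring
  have step : ∀ r ∈ Finset.range (N + 1), q ^ r ^ 2 * (qPochInv q q r * qPochInv q q (N - r) *
      qPochInv (-q) q N * qPochInv (-q) q (N + r)) =
      ∑ n ∈ Finset.range (N + 1), foldWeight q n * (-1) ^ n * q ^ (n ^ 2 + n.choose 2) *
        (qPochInv (-q) q (N - n) * qPochInv (-q) q (N + n)) *
        (q ^ r ^ 2 * (qPochInv q q (N - r) * (qPochInv q q (r - n) * qPochInv q q (r + n)))) := by
    intro r hr
    have hr' := Finset.mem_range.1 hr
    have hNN := qPoch_mul_qPochInv h' N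
    have h0 := sum_sixPhiFive h hx r
    rw [hd] at h0
    -- Inserting `(-q)_N / (-q)_N` creates `(-q)_N / (-q)_(N+r) = 1 / (xq;q)_r` with `x = -q^N`, the
    -- shape needed for `sum_sixPhiFive`.
    have h1 : q ^ r ^ 2 * (qPochInv q q r * qPochInv q q (N - r) *
        qPochInv (-q) q N * qPochInv (-q) q (N + r)) =
        q ^ r ^ 2 * qPochInv q q (N - r) * qPochInv (-q) q N ^ 2 *
          (qPochInv q q r * (qPoch (-q) q N * qPochInv (-q) q (N + r))) := by
      linear_combination (-(q ^ r ^ 2 * (qPochInv q q r * qPochInv q q (N - r) *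
        qPochInv (-q) q N * qPochInv (-q) q (N + r)))) * hNN
    rw [h1, ← h0, Finset.mul_sum]
    refine Finset.sum_subset_zero_on_sdiff (Finset.range_mono (by lia)) ?_ ?_
    · intro n hn
      simp only [Finset.mem_sdiff, Finset.mem_range] at hn
      rw [qPochInv_of_neg q q (m := (r : ℤ) - n) (by lia)]
      ring
    · intro n hn
      have hn' := Finset.mem_range.1 hn
      rw [prod_neg_pow_sub_pow h' (by lia), hd, pow_add]
      linear_combination (foldWeight q n * (-1) ^ n * (q ^ n ^ 2 * q ^ n.choose 2) *
        (qPochInv (-q) q (N - n) * qPochInv (-q) q (N + n)) *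
        (q ^ r ^ 2 * (qPochInv q q (N - r) * (qPochInv q q (r - n) * qPochInv q q (r + n))))) *
        (qPochInv (-q) q N * qPoch (-q) q N + 1) * hNN
  rw [Finset.sum_congr rfl step, Finset.sum_comm]
  refine Finset.sum_congr rfl fun n _ => ?_
  rw [← Finset.mul_sum, sum_baileyKernel h, qPochInv_sq h h', qPochInv_sq h h']
  ring

/-- The finite form of the double-sum identity. -/
lemma sum_doubleSum_finite {q : A} (h : ∀ j : ℕ, IsUnit (1 - q * q ^ j))
    (h' : ∀ j : ℕ, IsUnit (1 - -q * q ^ j)) (M : ℕ) :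
    ∑ N ∈ Finset.range (M + 1), ∑ r ∈ Finset.range (N + 1),
      q ^ (2 * N ^ 2 + r ^ 2) * (qPochInv (q ^ 2) (q ^ 2) (M - N) *
        (qPochInv q q r * qPochInv q q (N - r) * qPochInv (-q) q N * qPochInv (-q) q (N + r))) =
    ∑ n ∈ Finset.range (M + 1), foldWeight q n * (-1) ^ n * q ^ (4 * n ^ 2 + n.choose 2) *
      (qPochInv (q ^ 2) (q ^ 2) (M - n) * qPochInv (q ^ 2) (q ^ 2) (M + n)) := by
  have step : ∀ N ∈ Finset.range (M + 1), ∑ r ∈ Finset.range (N + 1),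
      q ^ (2 * N ^ 2 + r ^ 2) * (qPochInv (q ^ 2) (q ^ 2) (M - N) *
        (qPochInv q q r * qPochInv q q (N - r) * qPochInv (-q) q N * qPochInv (-q) q (N + r))) =
      ∑ n ∈ Finset.range (M + 1), foldWeight q n * (-1) ^ n * q ^ (2 * n ^ 2 + n.choose 2) *
        ((q ^ 2) ^ N ^ 2 * (qPochInv (q ^ 2) (q ^ 2) (M - N) *
          (qPochInv (q ^ 2) (q ^ 2) (N - n) * qPochInv (q ^ 2) (q ^ 2) (N + n)))) := by
    intro N hN
    have hN' := Finset.mem_range.1 hN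
    have h1 : ∀ r ∈ Finset.range (N + 1),
      q ^ (2 * N ^ 2 + r ^ 2) * (qPochInv (q ^ 2) (q ^ 2) (M - N) *
        (qPochInv q q r * qPochInv q q (N - r) * qPochInv (-q) q N * qPochInv (-q) q (N + r))) =
        q ^ (2 * N ^ 2) * qPochInv (q ^ 2) (q ^ 2) (M - N) *
        (q ^ r ^ 2 * (qPochInv q q r * qPochInv q q (N - r) *
          qPochInv (-q) q N * qPochInv (-q) q (N + r))) := fun r _ => by ring
    rw [Finset.sum_congr rfl h1, ← Finset.mul_sum, sum_baileyPair h h', Finset.mul_sum]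
    refine Finset.sum_subset_zero_on_sdiff (Finset.range_mono (by lia)) ?_ fun n _ => by ring
    intro n hn
    simp only [Finset.mem_sdiff, Finset.mem_range] at hn
    rw [qPochInv_of_neg _ _ (m := (N : ℤ) - n) (by lia)]
    ring
  rw [Finset.sum_congr rfl step, Finset.sum_comm]
  refine Finset.sum_congr rfl fun n _ => ?_
  rw [← Finset.mul_sum, sum_baileyKernel (isUnit_one_sub_sq h h')]
  ring

end BaileyPair

/-! ### A finite Jacobi triple product, and its case of modulus 9 -/

section JacobiTripleProduct

variable {A : Type*} [CommRing A]

/-- The term `a ^ (n (n + 1) / 2) * b ^ (n (n - 1) / 2)` of the theta series. -/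
def thetaTerm (a b : A) (n : ℤ) : A := a ^ (n * (n + 1) / 2).toNat * b ^ (n * (n - 1) / 2).toNat

lemma thetaTerm_neg (a b : A) (n : ℤ) : thetaTerm a b (-n) = thetaTerm b a n := by
  have e1 : -n * (-n + 1) = n * (n - 1) := by ring
  have e2 : -n * (-n - 1) = n * (n + 1) := by ring
  rw [thetaTerm, thetaTerm, e1, e2, mul_comm]

lemma thetaTerm_natCast (a b : A) (n : ℕ) :
    thetaTerm a b n = a ^ (n + n.choose 2) * b ^ n.choose 2 := by
  have e : ((n.choose 2 : ℕ) : ℤ) = (n : ℤ) * (n - 1) / 2 := by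
    rw [Nat.choose_two_right]
    cases n with
    | zero => simp
    | succ n => push_cast; simp
  have e1 : (n : ℤ) * (n + 1) = n * (n - 1) + n * 2 := by ring
  rw [thetaTerm, e1, Int.add_mul_ediv_right _ _ (by norm_num), ← e]
  congr 2
  lia

/-- The ratio of consecutive terms is `a (ab)^n`; multiplying by `(ab)^(K-n)` keeps every exponent
nonnegative, so `a` and `b` need not be invertible. -/
lemma thetaTerm_succ (a b : A) (K : ℕ) (n : ℤ) (hn : n ≤ K) :
    thetaTerm a b (n + 1) * (a * b) ^ ((K : ℤ) - n).toNat = a * (a * b) ^ K * thetaTerm a b n := by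
  have e1 : (n + 1) * (n + 1 + 1) = n * (n + 1) + (n + 1) * 2 := by ring
  have e2 : (n + 1) * (n + 1 - 1) = n * (n - 1) + n * 2 := by ring
  have e3 : n * (n + 1) = n * (n - 1) + n * 2 := by ring
  have h1 : 0 ≤ n * (n - 1) / 2 := by
    apply Int.ediv_nonneg _ (by norm_num)
    rcases lt_or_ge 0 n with h | h <;> nlinarith
  have h2 : 0 ≤ n * (n + 1) / 2 := by
    apply Int.ediv_nonneg _ (by norm_num)
    rcases lt_or_ge (-1) n with h | h <;> nlinarith
  have h3 : 0 ≤ (n + 1) * (n + 1 + 1) / 2 := by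
    apply Int.ediv_nonneg _ (by norm_num)
    rcases lt_or_ge (-2) n with h | h <;> nlinarith
  have h4 : 0 ≤ (n + 1) * (n + 1 - 1) / 2 := by
    apply Int.ediv_nonneg _ (by norm_num)
    rcases lt_or_ge (-1) n with h | h <;> nlinarith
  have f1 : (n + 1) * (n + 1 + 1) / 2 = n * (n + 1) / 2 + (n + 1) := by
    rw [e1, Int.add_mul_ediv_right _ _ (by norm_num)]
  have f2 : (n + 1) * (n + 1 - 1) / 2 = n * (n - 1) / 2 + n := by
    rw [e2, Int.add_mul_ediv_right _ _ (by norm_num)]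
  have f3 : ((n + 1) * (n + 1 + 1) / 2).toNat + ((K : ℤ) - n).toNat =
      1 + K + (n * (n + 1) / 2).toNat := by lia
  have f4 : ((n + 1) * (n + 1 - 1) / 2).toNat + ((K : ℤ) - n).toNat =
      K + (n * (n - 1) / 2).toNat := by lia
  calc _ = a ^ (((n + 1) * (n + 1 + 1) / 2).toNat + ((K : ℤ) - n).toNat) *
        b ^ (((n + 1) * (n + 1 - 1) / 2).toNat + ((K : ℤ) - n).toNat) := by
        rw [thetaTerm]; ring
    _ = _ := by rw [f3, f4, thetaTerm]; ring

/-- The truncated theta series `∑ (-1)^n t_n / ((Q; Q)_{K - n} (Q; Q)_{L + n})`, up to a sign. -/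
noncomputable def thetaSum (a b : A) (K L : ℕ) : A :=
  ∑ j ∈ Finset.range (K + L + 1), (-1) ^ j * thetaTerm a b (j - L) *
    (qPochInv (a * b) (a * b) ((K + L : ℕ) - j) * qPochInv (a * b) (a * b) j)

lemma thetaSum_swap (a b : A) (K L : ℕ) : thetaSum a b K L = (-1) ^ (K + L) * thetaSum b a L K := by
  rw [thetaSum, ← Finset.sum_range_reflect, thetaSum, Finset.mul_sum, add_comm L K]
  refine Finset.sum_congr rfl fun j hj => ?_
  have hj' := Finset.mem_range.1 hj
  obtain ⟨t, ht⟩ := Nat.exists_eq_add_of_le (Finset.mem_range_succ_iff.1 hj)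
  have e1 : K + L + 1 - 1 - j = t := by lia
  have e2 : ((t : ℕ) : ℤ) - L = -(j - K) := by lia
  have e3 : ((K + L : ℕ) : ℤ) - t = j := by lia
  have e4 : ((K + L : ℕ) : ℤ) - j = t := by lia
  have e5 : (-1 : A) ^ t = (-1) ^ (j + t) * (-1) ^ j := by
    rw [pow_add, mul_comm, ← mul_assoc, ← pow_add, ← two_mul]; simp
  rw [e1, e2, e3, e4, thetaTerm_neg, mul_comm b a, ht, e5]
  ring

/-- The `q`-Pascal splitting again: one part is the sum itself, the other, shifted by one, is `-a
Q^K` times it by `thetaTerm_succ`, where `Q = ab`. -/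
lemma thetaSum_succ {a b : A} (h : ∀ j : ℕ, IsUnit (1 - a * b * (a * b) ^ j)) (K L : ℕ) :
    (1 - (a * b) ^ (K + L + 1)) * thetaSum a b (K + 1) L =
      (1 - a * (a * b) ^ K) * thetaSum a b K L := by
  set Q := a * b with hQ
  have key : ∀ j ∈ Finset.range (K + 1 + L + 1), (1 - Q ^ (K + L + 1)) * ((-1) ^ j *
      thetaTerm a b (j - L) * (qPochInv Q Q ((K + 1 + L : ℕ) - j) * qPochInv Q Q j)) =
      (-1) ^ j * thetaTerm a b (j - L) * (qPochInv Q Q ((K + L : ℕ) - j) * qPochInv Q Q j) +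
      (-1) ^ j * (thetaTerm a b (j - L) * Q ^ (K + L + 1 - j)) *
        (qPochInv Q Q ((K + L + 1 : ℕ) - j) * qPochInv Q Q (j - 1)) := by
    intro j hj
    have hj' := Finset.mem_range.1 hj
    obtain ⟨t, ht⟩ := Nat.exists_eq_add_of_le (show j ≤ K + L + 1 by lia)
    have h1 := qPochInv_sub_one h t
    have h2 := qPochInv_sub_one h j
    have e1 : ((K + 1 + L : ℕ) : ℤ) - j = t := by lia
    have e2 : ((K + L : ℕ) : ℤ) - j = t - 1 := by lia
    have e3 : ((K + L + 1 : ℕ) : ℤ) - j = t := by lia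
    have e4 : K + L + 1 - j = t := by lia
    rw [Int.toNat_natCast] at h1 h2
    rw [e1, e2, e3, e4, h1, h2, ht]
    ring
  have e0 : K + 1 + L + 1 = K + L + 1 + 1 := by ring
  rw [thetaSum, Finset.mul_sum, Finset.sum_congr rfl key, Finset.sum_add_distrib, e0,
    Finset.sum_range_succ, Finset.sum_range_succ' (n := K + L + 1)]
  have step : ∀ j ∈ Finset.range (K + L + 1),
      (-1) ^ (j + 1) * (thetaTerm a b ((j + 1 : ℕ) - L) * Q ^ (K + L + 1 - (j + 1))) *
        (qPochInv Q Q ((K + L + 1 : ℕ) - (j + 1 : ℕ)) * qPochInv Q Q ((j + 1 : ℕ) - 1)) =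
      -(a * Q ^ K) * ((-1) ^ j * thetaTerm a b (j - L) *
        (qPochInv Q Q ((K + L : ℕ) - j) * qPochInv Q Q j)) := by
    intro j hj
    have hj' := Finset.mem_range.1 hj
    have h1 := thetaTerm_succ a b K (j - L) (by lia)
    have e1 : K + L + 1 - (j + 1) = ((K : ℤ) - (j - L)).toNat := by lia
    have e2 : ((j + 1 : ℕ) : ℤ) - L = j - L + 1 := by push_cast; ring
    have e3 : ((K + L + 1 : ℕ) : ℤ) - (j + 1 : ℕ) = (K + L : ℕ) - j := by push_cast; ring
    have e4 : ((j + 1 : ℕ) : ℤ) - 1 = j := by push_cast; ring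
    rw [e1, e2, e3, e4, hQ, h1]
    ring
  rw [Finset.sum_congr rfl step, ← Finset.mul_sum,
    qPochInv_of_neg Q Q (m := ((K + L : ℕ) : ℤ) - (K + L + 1 : ℕ)) (by lia),
    qPochInv_of_neg Q Q (m := ((0 : ℕ) : ℤ) - 1) (by lia), thetaSum]
  ring

lemma thetaSum_eq_of_zero {a b : A} (h : ∀ j : ℕ, IsUnit (1 - a * b * (a * b) ^ j)) {L : ℕ} {v : A}
    (h0 : thetaSum a b 0 L = v * qPochInv (a * b) (a * b) L) (K : ℕ) :
    thetaSum a b K L = v * qPoch a (a * b) K * qPochInv (a * b) (a * b) (K + L : ℕ) := by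
  induction K with
  | zero => simpa [qPoch_zero] using h0
  | succ K ih =>
    have hu := h (K + L)
    have h1 := qPochInv_nat h (K + L)
    rw [← pow_succ'] at hu h1
    apply hu.mul_left_cancel
    have e : K + 1 + L = K + L + 1 := by ring
    rw [thetaSum_succ h, ih, h1, qPoch_succ, e]
    ring

/-- Independent cut-offs allow growing one side at a time: `L` from the trivial sum via
`thetaSum_swap`, then `K`. The sign `(-1)^L` comes from indexing by `j = n + L`. -/
lemma thetaSum_eq {a b : A} (h : ∀ j : ℕ, IsUnit (1 - a * b * (a * b) ^ j)) (K L : ℕ) :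
    thetaSum a b K L =
      (-1) ^ L * qPoch b (a * b) L * qPoch a (a * b) K * qPochInv (a * b) (a * b) (K + L : ℕ) := by
  have h' : ∀ j : ℕ, IsUnit (1 - b * a * (b * a) ^ j) := by simpa only [mul_comm b a] using h
  refine thetaSum_eq_of_zero h ?_ K
  rw [thetaSum_swap, thetaSum_eq_of_zero (v := 1) h']
  · rw [mul_comm b a]; simp; ring
  · simp [thetaSum, thetaTerm, qPochInv_zero]

/-- A finite form of the Jacobi triple product identity. -/
lemma sum_thetaTerm_finite {a b : A} (h : ∀ j : ℕ, IsUnit (1 - a * b * (a * b) ^ j)) (M : ℕ) :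
    ∑ n ∈ Finset.range (M + 1), (-1) ^ n *
      (if n = 0 then 1 else thetaTerm a b n + thetaTerm b a n) *
      (qPochInv (a * b) (a * b) (M - n) * qPochInv (a * b) (a * b) (M + n)) =
    qPoch a (a * b) M * qPoch b (a * b) M * qPochInv (a * b) (a * b) (2 * M : ℕ) := by
  have hs : ((-1 : A) ^ M) * (-1) ^ M = 1 := by rw [← pow_add, ← two_mul]; simp
  have h1 := thetaSum_eq h M M
  -- Splits the bilateral sum at `j = M`, that is `n = 0`, and reflects the negative half so that
  -- `n` and `-n` can be paired.
  rw [thetaSum, add_assoc, Finset.sum_range_add, ← Finset.sum_range_reflect,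
    Finset.sum_range_succ'] at h1
  rw [Finset.sum_range_succ']
  have h2 : ∀ i ∈ Finset.range M, (-1 : A) ^ (M - 1 - i) * thetaTerm a b ((M - 1 - i : ℕ) - M) *
      (qPochInv (a * b) (a * b) ((M + M : ℕ) - (M - 1 - i : ℕ)) *
        qPochInv (a * b) (a * b) (M - 1 - i : ℕ)) =
      (-1) ^ M * ((-1) ^ (i + 1) * thetaTerm b a (i + 1 : ℕ) *
      (qPochInv (a * b) (a * b) (M - (i + 1 : ℕ)) *
        qPochInv (a * b) (a * b) (M + (i + 1 : ℕ)))) := by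
    intro i hi
    obtain ⟨t, rfl⟩ := Nat.exists_eq_add_of_le (Nat.succ_le_of_lt (Finset.mem_range.1 hi))
    have e1 : i + 1 + t - 1 - i = t := by lia
    have e2 : (t : ℤ) - (i + 1 + t : ℕ) = -(i + 1 : ℕ) := by lia
    have e3 : ((i + 1 + t + (i + 1 + t) : ℕ) : ℤ) - t = (i + 1 + t : ℕ) + (i + 1 : ℕ) := by lia
    have e4 : ((i + 1 + t : ℕ) : ℤ) - (i + 1 : ℕ) = t := by lia
    have e5 : (-1 : A) ^ t = (-1) ^ (i + 1 + t) * (-1) ^ (i + 1) := by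
      rw [pow_add _ (i + 1), mul_comm, ← mul_assoc, ← pow_add, ← two_mul]; simp
    rw [Nat.succ_eq_add_one, e1, e2, e3, e4, e5, thetaTerm_neg]
    ring
  have h3 : ∀ i ∈ Finset.range M, (-1 : A) ^ (M + (i + 1)) * thetaTerm a b ((M + (i + 1) : ℕ) - M) *
      (qPochInv (a * b) (a * b) ((M + M : ℕ) - (M + (i + 1) : ℕ)) *
        qPochInv (a * b) (a * b) (M + (i + 1) : ℕ)) =
      (-1) ^ M * ((-1) ^ (i + 1) * thetaTerm a b (i + 1 : ℕ) *
      (qPochInv (a * b) (a * b) (M - (i + 1 : ℕ)) *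
        qPochInv (a * b) (a * b) (M + (i + 1 : ℕ)))) := by
    intro i _
    have e1 : ((M + (i + 1) : ℕ) : ℤ) - M = (i + 1 : ℕ) := by push_cast; ring
    have e2 : ((M + M : ℕ) : ℤ) - (M + (i + 1) : ℕ) = M - (i + 1 : ℕ) := by push_cast; ring
    have e3 : ((M + (i + 1) : ℕ) : ℤ) = M + (i + 1 : ℕ) := by push_cast; ring
    rw [e1, e2, e3]
    ring
  have h4 : ∀ i ∈ Finset.range M, (-1) ^ (i + 1) *
      (if i + 1 = 0 then 1 else thetaTerm a b (i + 1 : ℕ) + thetaTerm b a (i + 1 : ℕ)) *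
      (qPochInv (a * b) (a * b) (M - (i + 1 : ℕ)) * qPochInv (a * b) (a * b) (M + (i + 1 : ℕ))) =
      (-1) ^ (i + 1) * thetaTerm b a (i + 1 : ℕ) *
      (qPochInv (a * b) (a * b) (M - (i + 1 : ℕ)) *
        qPochInv (a * b) (a * b) (M + (i + 1 : ℕ))) +
      (-1) ^ (i + 1) * thetaTerm a b (i + 1 : ℕ) *
      (qPochInv (a * b) (a * b) (M - (i + 1 : ℕ)) *
        qPochInv (a * b) (a * b) (M + (i + 1 : ℕ))) := by
    intro i _
    rw [if_neg (Nat.succ_ne_zero i)]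
    ring
  rw [Finset.sum_congr rfl h2, Finset.sum_congr rfl h3, ← Finset.mul_sum, ← Finset.mul_sum] at h1
  rw [Finset.sum_congr rfl h4, Finset.sum_add_distrib]
  have e1 : ((M + M : ℕ) : ℤ) - (M + 0 : ℕ) = M := by push_cast; ring
  have e2 : ((M + 0 : ℕ) : ℤ) - M = 0 := by push_cast; ring
  have e3 : thetaTerm a b 0 = 1 := by simp [thetaTerm]
  rw [e1, e2, e3] at h1
  simp only [Nat.cast_zero, sub_zero, add_zero, if_true, pow_zero, one_mul] at h1 ⊢
  rw [two_mul]
  have hM : IsUnit ((-1 : A) ^ M) := IsUnit.of_mul_eq_one _ hs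
  apply hM.mul_left_cancel
  linear_combination h1

/-- The finite triple product for the theta series of modulus `9`. -/
lemma sum_theta_nine_finite {q : A} (h : ∀ j : ℕ, IsUnit (1 - q ^ 9 * (q ^ 9) ^ j)) (M : ℕ) :
    ∑ n ∈ Finset.range (M + 1), foldWeight q n * (-1) ^ n * q ^ (4 * n ^ 2 + n.choose 2) *
      (qPochInv (q ^ 9) (q ^ 9) (M - n) * qPochInv (q ^ 9) (q ^ 9) (M + n)) =
    qPoch (q ^ 4) (q ^ 9) M * qPoch (q ^ 5) (q ^ 9) M *
      qPochInv (q ^ 9) (q ^ 9) (2 * M : ℕ) := by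
  have e : q ^ 4 * q ^ 5 = q ^ 9 := by ring
  have h1 := sum_thetaTerm_finite (a := q ^ 4) (b := q ^ 5) (by simpa only [e] using h) M
  rw [e] at h1
  rw [← h1]
  refine Finset.sum_congr rfl fun n _ => ?_
  by_cases hn : n = 0
  · simp [hn, foldWeight]
  -- Hence `4n² + n(n-1)/2 = 4n + 9n(n-1)/2`, the exponent of `thetaTerm (q ^ 4) (q ^ 5) n`; the
  -- swapped term has an extra `q^n`, matching `foldWeight`.
  · have h2 : n ^ 2 = n + 2 * n.choose 2 := by
      obtain ⟨k, rfl⟩ := Nat.exists_eq_succ_of_ne_zero hn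
      have h3 := Nat.div_mul_cancel (Nat.even_mul_succ_self k).two_dvd
      rw [Nat.choose_two_right, Nat.succ_sub_one, Nat.succ_eq_add_one, mul_comm (k + 1) k]
      nlinarith
    rw [thetaTerm_natCast, thetaTerm_natCast, foldWeight, if_neg hn, if_neg hn, h2]
    ring

end JacobiTripleProduct

/-! ### Convergence principles common to both settings -/

section Limits

open Filter Topology
open scoped Pointwise

/-- The convergence principles used for passing to the limit in finite `q`-series identities:
a notion of boundedness for which bounded perturbations of `q ^ j` give convergent products, and
for which Tannery's theorem holds for series of the form `∑ q ^ e i * u i`. -/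
structure QLimitPrinciples {A : Type*} [CommRing A] [TopologicalSpace A] (q : A)
    (Bdd : Set A → Prop) : Prop where
  mono : ∀ {S T : Set A}, S ⊆ T → Bdd T → Bdd S
  union : ∀ {S T : Set A}, Bdd S → Bdd T → Bdd (S ∪ T)
  mul : ∀ {S T : Set A}, Bdd S → Bdd T → Bdd (S * T)
  of_tendsto : ∀ {u : ℕ → A} {l : A}, Tendsto u atTop (𝓝 l) → Bdd (Set.range u)
  of_tendsto_inverse : ∀ {u : ℕ → A}, Tendsto u atTop (𝓝 1) →
    Bdd (Set.range fun j => Ring.inverse (u j))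
  tendsto_pow : Tendsto (fun j : ℕ => q ^ j) atTop (𝓝 0)
  multipliable : ∀ {u : ℕ → A}, Bdd (Set.range u) → Multipliable fun j : ℕ => 1 + q ^ j * u j
  tannery : ∀ {ι : Type} {e : ι → ℕ} {S : Set A} {u : ℕ → ι → A} {v : ι → A},
    (∀ x : ℝ, 0 ≤ x → x < 1 → Summable fun i => x ^ e i) → Bdd S → (∀ M i, u M i ∈ S) →
    (∀ i, Tendsto (fun M => u M i) atTop (𝓝 (v i))) →
    (Summable fun i => q ^ e i * v i) ∧
      Tendsto (fun M => ∑' i, q ^ e i * u M i) atTop (𝓝 (∑' i, q ^ e i * v i))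

namespace QLimitPrinciples

variable {A : Type*} [CommRing A] [TopologicalSpace A] {q : A} {Bdd : Set A → Prop}

lemma bdd_singleton (H : QLimitPrinciples q Bdd) (a : A) : Bdd {a} := by
  have := H.of_tendsto (u := fun _ => a) tendsto_const_nhds
  rwa [Set.range_const] at this

lemma bdd_mul_range (H : QLimitPrinciples q Bdd) {u v : ℕ → A} (hu : Bdd (Set.range u))
    (hv : Bdd (Set.range v)) : Bdd (Set.range fun j => u j * v j) := by
  refine H.mono ?_ (H.mul hu hv)
  rintro _ ⟨j, rfl⟩
  exact Set.mul_mem_mul ⟨j, rfl⟩ ⟨j, rfl⟩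

lemma bdd_mul_pow (H : QLimitPrinciples q Bdd) (a : A) (k : ℕ) :
    Bdd (Set.range fun j : ℕ => a * (q ^ k) ^ j) := by
  refine H.mono ?_ (H.mul (H.bdd_singleton a) (H.of_tendsto H.tendsto_pow))
  rintro _ ⟨j, rfl⟩
  exact Set.mul_mem_mul rfl ⟨k * j, pow_mul q k j⟩

lemma qPochConverges (H : QLimitPrinciples q Bdd) (a : A) (k : ℕ) :
    QPochConverges a (q ^ (k + 1)) := by
  have h := H.multipliable (H.bdd_mul_pow (-a) k)
  unfold QPochConverges
  convert h using 2 with j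
  ring

lemma tendsto_qPoch (H : QLimitPrinciples q Bdd) (a : A) (k : ℕ) :
    Tendsto (qPoch a (q ^ (k + 1))) atTop (𝓝 (qPochInf a (q ^ (k + 1)))) :=
  (H.qPochConverges a k).hasProd.tendsto_prod_nat

variable [IsTopologicalRing A]

/-- Inversion is not assumed continuous. Instead the reciprocals are partial products of another
convergent product, since `1 / (1 - y) = 1 + y / (1 - y)`. -/
lemma tendsto_qPochInv_aux (H : QLimitPrinciples q Bdd) {a : A} {k : ℕ}
    (h : ∀ j : ℕ, IsUnit (1 - a * (q ^ (k + 1)) ^ j)) :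
    ∃ l : A, Tendsto (fun m : ℕ => qPochInv a (q ^ (k + 1)) m) atTop (𝓝 l) := by
  have h1 : Tendsto (fun j : ℕ => 1 - a * (q ^ (k + 1)) ^ j) atTop (𝓝 1) := by
    have : Tendsto (fun j : ℕ => (q ^ (k + 1)) ^ j) atTop (𝓝 0) := by
      simp_rw [← pow_mul]
      exact H.tendsto_pow.comp (tendsto_id.const_mul_atTop' (Nat.succ_pos k))
    simpa using (this.const_mul a).const_sub 1
  have h2 := H.multipliable (H.bdd_mul_range (H.bdd_mul_pow a k) (H.of_tendsto_inverse h1))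
  refine ⟨_, h2.hasProd.tendsto_prod_nat.congr fun m => ?_⟩
  induction m with
  | zero => simp [qPochInv_zero]
  | succ m ih =>
    rw [Finset.prod_range_succ, ih, qPochInv_nat h]
    have e := Ring.mul_inverse_cancel _ (h m)
    linear_combination a * (q ^ (k + 1)) ^ m * qPochInv a (q ^ (k + 1)) (m + 1 : ℕ) * e

variable [T2Space A]

lemma qPochInf_mul_inverse (H : QLimitPrinciples q Bdd) {a : A} {k : ℕ}
    (h : ∀ j : ℕ, IsUnit (1 - a * (q ^ (k + 1)) ^ j)) :
    IsUnit (qPochInf a (q ^ (k + 1))) ∧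
    Tendsto (fun m : ℕ => qPochInv a (q ^ (k + 1)) m) atTop
      (𝓝 (Ring.inverse (qPochInf a (q ^ (k + 1))))) := by
  obtain ⟨l, hl⟩ := H.tendsto_qPochInv_aux h
  have h1 : qPochInf a (q ^ (k + 1)) * l = 1 := by
    refine tendsto_nhds_unique ((H.tendsto_qPoch a k).mul hl) ?_
    simp_rw [qPoch_mul_qPochInv h]
    exact tendsto_const_nhds
  have hu : IsUnit (qPochInf a (q ^ (k + 1))) := IsUnit.of_mul_eq_one _ h1
  refine ⟨hu, ?_⟩
  convert hl using 2
  apply hu.mul_left_cancel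
  rw [Ring.mul_inverse_cancel _ hu, h1]

lemma bdd_qPochInv (H : QLimitPrinciples q Bdd) {a : A} {k : ℕ}
    (h : ∀ j : ℕ, IsUnit (1 - a * (q ^ (k + 1)) ^ j)) :
    Bdd (Set.range fun m : ℤ => qPochInv a (q ^ (k + 1)) m) := by
  refine H.mono ?_ (H.union (H.bdd_singleton 0) (H.of_tendsto (H.qPochInf_mul_inverse h).2))
  rintro _ ⟨m, rfl⟩
  rcases lt_or_ge m 0 with hm | hm
  · exact Or.inl (qPochInv_of_neg _ _ hm)
  · lift m to ℕ using hm
    exact Or.inr ⟨m, rfl⟩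

end QLimitPrinciples

lemma tendsto_natCast_sub {X : Type*} [TopologicalSpace X] {f : ℤ → X} {l : X}
    (h : Tendsto (fun m : ℕ => f m) atTop (𝓝 l)) (n : ℕ) :
    Tendsto (fun m : ℕ => f ((m : ℤ) - n)) atTop (𝓝 l) := by
  rw [← tendsto_add_atTop_iff_nat n]
  simpa using h

lemma summable_pow_of_le {e : ℕ → ℕ} (he : ∀ n, n ≤ e n) (x : ℝ) (h0 : 0 ≤ x) (h1 : x < 1) :
    Summable fun n => x ^ e n :=
  (summable_geometric_of_lt_one h0 h1).of_nonneg_of_le (fun _ => pow_nonneg h0 _)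
    fun n => pow_le_pow_of_le_one h0 h1.le (he n)

lemma summable_pow_of_add_le {e : ℕ × ℕ → ℕ} (he : ∀ p, p.1 + p.2 ≤ e p) (x : ℝ) (h0 : 0 ≤ x)
    (h1 : x < 1) : Summable fun p => x ^ e p := by
  have hg := summable_geometric_of_lt_one h0 h1
  refine (hg.mul_of_nonneg hg (fun _ => pow_nonneg h0 _) fun _ => pow_nonneg h0 _).of_nonneg_of_le
    (fun _ => pow_nonneg h0 _) fun p => ?_
  rw [← pow_add]
  exact pow_le_pow_of_le_one h0 h1.le (he p)

/-! ### Passage to the limit in the finite identities -/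

namespace QLimitPrinciples

variable {A : Type*} [CommRing A] [TopologicalSpace A] {q : A} {Bdd : Set A → Prop}
  [IsTopologicalRing A]

lemma bdd_foldWeight (H : QLimitPrinciples q Bdd) :
    Bdd (Set.range fun n => foldWeight q n * (-1) ^ n) := by
  have h1 : Tendsto (fun n => foldWeight q n) atTop (𝓝 1) := by
    have h2 : Tendsto (fun n : ℕ => 1 + q ^ n) atTop (𝓝 1) := by
      simpa using H.tendsto_pow.const_add 1
    refine h2.congr' ?_
    filter_upwards [eventually_ne_atTop 0] with n hn
    simp [foldWeight, hn]
  refine H.bdd_mul_range (H.of_tendsto h1)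
    (H.mono ?_ (H.union (H.bdd_singleton 1) (H.bdd_singleton (-1))))
  rintro _ ⟨n, rfl⟩
  exact neg_one_pow_eq_or A n

/-- The theta series `∑ (-1)^n q^{(9n² - n)/2}` over the integers, folded. -/
noncomputable def theta (q : A) : A :=
  ∑' n : ℕ, q ^ (4 * n ^ 2 + n.choose 2) * (foldWeight q n * (-1) ^ n)

lemma summable_theta (H : QLimitPrinciples q Bdd) :
    Summable fun n : ℕ => q ^ (4 * n ^ 2 + n.choose 2) * (foldWeight q n * (-1) ^ n) :=
  (H.tannery (u := fun _ n => foldWeight q n * (-1) ^ n)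
    (summable_pow_of_le fun n => by nlinarith [Nat.zero_le (n.choose 2)]) H.bdd_foldWeight
    (fun _ n => ⟨n, rfl⟩) fun _ => tendsto_const_nhds).1

variable [T2Space A]

/-- The same theta numerator occurs over base `q^9` in the triple product and over base `q²` in the
double sum, so the base is left general. -/
lemma tendsto_sum_theta (H : QLimitPrinciples q Bdd) {k : ℕ}
    (h : ∀ j : ℕ, IsUnit (1 - q ^ (k + 1) * (q ^ (k + 1)) ^ j)) :
    Tendsto (fun M : ℕ => ∑ n ∈ Finset.range (M + 1),
      foldWeight q n * (-1) ^ n * q ^ (4 * n ^ 2 + n.choose 2) *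
        (qPochInv (q ^ (k + 1)) (q ^ (k + 1)) (M - n) *
          qPochInv (q ^ (k + 1)) (q ^ (k + 1)) (M + n))) atTop
      (𝓝 (theta q * Ring.inverse (qPochInf (q ^ (k + 1)) (q ^ (k + 1))) ^ 2)) := by
  set Q := q ^ (k + 1) with hQ
  have hl : Tendsto (fun m : ℕ => qPochInv Q Q m) atTop (𝓝 (Ring.inverse (qPochInf Q Q))) :=
    (H.qPochInf_mul_inverse h).2
  have hb : Bdd (Set.range fun m : ℤ => qPochInv Q Q m) := H.bdd_qPochInv h
  have ht := (H.tannery (e := fun n : ℕ => 4 * n ^ 2 + n.choose 2)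
    (u := fun M n => foldWeight q n * (-1) ^ n * (qPochInv Q Q (M - n) * qPochInv Q Q (M + n)))
    (v := fun n => foldWeight q n * (-1) ^ n * Ring.inverse (qPochInf Q Q) ^ 2)
    (summable_pow_of_le fun n => by nlinarith [Nat.zero_le (n.choose 2)])
    (H.mul H.bdd_foldWeight (H.mul hb hb))
    (fun M n => Set.mul_mem_mul ⟨n, rfl⟩ (Set.mul_mem_mul ⟨_, rfl⟩ ⟨_, rfl⟩)) ?_).2
  · have e : ∑' n : ℕ, q ^ (4 * n ^ 2 + n.choose 2) *
        (foldWeight q n * (-1) ^ n * Ring.inverse (qPochInf Q Q) ^ 2) =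
        theta q * Ring.inverse (qPochInf Q Q) ^ 2 := by
      rw [theta, ← H.summable_theta.tsum_mul_right]
      exact tsum_congr fun n => by ring
    rw [e] at ht
    refine ht.congr fun M => ?_
    rw [tsum_eq_sum (s := Finset.range (M + 1))]
    · exact Finset.sum_congr rfl fun n _ => by ring
    · intro n hn
      have hn' := Finset.mem_range.not.1 hn
      rw [qPochInv_of_neg Q Q (m := (M : ℤ) - n) (by lia)]
      ring
  · intro n
    rw [sq]
    refine ((tendsto_natCast_sub hl n).mul ?_).const_mul _
    have := (tendsto_add_atTop_iff_nat n).2 hl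
    simpa only [Nat.cast_add] using this

/-- The triple product form of the theta series. -/
lemma theta_eq (H : QLimitPrinciples q Bdd) (h : ∀ j : ℕ, IsUnit (1 - q ^ 9 * (q ^ 9) ^ j)) :
    theta q = qPochInf₃ (q ^ 4) (q ^ 5) (q ^ 9) (q ^ 9) := by
  obtain ⟨hu, hl⟩ := H.qPochInf_mul_inverse (k := 8) h
  have h1 := H.tendsto_sum_theta (k := 8) h
  simp only [Nat.reduceAdd] at h1 hl hu
  simp_rw [sum_theta_nine_finite h] at h1
  have h2 : Tendsto (fun M : ℕ => qPochInv (q ^ 9) (q ^ 9) (2 * M : ℕ)) atTop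
      (𝓝 (Ring.inverse (qPochInf (q ^ 9) (q ^ 9)))) :=
    hl.comp (tendsto_id.const_mul_atTop' two_pos)
  have h3 := tendsto_nhds_unique h1
    (((H.tendsto_qPoch (q ^ 4) 8).mul (H.tendsto_qPoch (q ^ 5) 8)).mul h2)
  simp only [Nat.reduceAdd] at h3
  have h4 := Ring.mul_inverse_cancel _ hu
  set L := qPochInf (q ^ 9) (q ^ 9)
  set E := Ring.inverse L
  rw [qPochInf₃]
  linear_combination L ^ 2 * h3 - (theta q * (L * E + 1) -
    qPochInf (q ^ 4) (q ^ 9) * qPochInf (q ^ 5) (q ^ 9) * L) * h4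

/-- Reciprocal of the denominator of the double sum. -/
noncomputable def summandInv (q : A) (n r : ℕ) : A :=
  qPochInv q q r * qPochInv q q n * qPochInv (-q) q (n + r : ℕ) * qPochInv (-q) q (n + 2 * r : ℕ)

lemma sum_range_sum_range_eq_tsum {X : Type*} [AddCommMonoid X] [TopologicalSpace X] (M : ℕ)
    {f : ℕ × ℕ → X} (hf : ∀ p, M < p.1 + p.2 → f p = 0) :
    ∑ N ∈ Finset.range (M + 1), ∑ r ∈ Finset.range (N + 1), f (N - r, r) = ∑' p, f p := by
  have hd : Set.PairwiseDisjoint (Finset.range (M + 1) : Set ℕ)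
      (Finset.HasAntidiagonal.antidiagonal : ℕ → Finset (ℕ × ℕ)) := fun i _ j _ hij =>
    Finset.disjoint_left.2 fun p hp hp' =>
      hij ((Finset.HasAntidiagonal.mem_antidiagonal.1 hp).symm.trans
        (Finset.HasAntidiagonal.mem_antidiagonal.1 hp'))
  rw [tsum_eq_sum (s := (Finset.range (M + 1)).disjiUnion _ hd), Finset.sum_disjiUnion]
  · refine Finset.sum_congr rfl fun N _ => ?_
    rw [← Finset.Nat.sum_antidiagonal_swap,
      Finset.Nat.sum_antidiagonal_eq_sum_range_succ_mk]
    rfl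
  · intro p hp
    apply hf
    by_contra hlt
    exact hp (Finset.mem_disjiUnion.2
      ⟨p.1 + p.2, Finset.mem_range.2 (by lia), Finset.HasAntidiagonal.mem_antidiagonal.2 rfl⟩)

lemma hasSum_doubleSum (H : QLimitPrinciples q Bdd) (h : ∀ j : ℕ, IsUnit (1 - q * q ^ j))
    (h' : ∀ j : ℕ, IsUnit (1 - -q * q ^ j)) :
    HasSum (fun p : ℕ × ℕ => q ^ (2 * p.1 ^ 2 + 4 * p.1 * p.2 + 3 * p.2 ^ 2) *
      summandInv q p.1 p.2) (theta q * Ring.inverse (qPochInf (q ^ 2) (q ^ 2))) := by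
  have h2 := isUnit_one_sub_sq h h'
  obtain ⟨hu, hl⟩ := H.qPochInf_mul_inverse (k := 1) h2
  have hb := H.bdd_qPochInv (k := 1) h2
  have hb1 := H.bdd_qPochInv (a := q) (k := 0) (by simpa using h)
  have hb2 := H.bdd_qPochInv (a := -q) (k := 0) (by simpa using h')
  have hR := H.tendsto_sum_theta (k := 1) h2
  simp only [Nat.reduceAdd, pow_one] at hu hl hb hb1 hb2 hR
  set P2 := qPochInv (q ^ 2) (q ^ 2)
  set L := qPochInf (q ^ 2) (q ^ 2)
  set E := Ring.inverse L
  obtain ⟨hs, ht⟩ := H.tannery (e := fun p : ℕ × ℕ => 2 * p.1 ^ 2 + 4 * p.1 * p.2 + 3 * p.2 ^ 2)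
    (u := fun M p => P2 (M - (p.1 + p.2 : ℕ)) * summandInv q p.1 p.2)
    (v := fun p => E * summandInv q p.1 p.2)
    (summable_pow_of_add_le fun p => by nlinarith [Nat.zero_le (p.1 * p.2)])
    (H.mul hb (H.mul (H.mul (H.mul hb1 hb1) hb2) hb2))
    (fun M p => Set.mul_mem_mul ⟨_, rfl⟩ (Set.mul_mem_mul (Set.mul_mem_mul
      (Set.mul_mem_mul ⟨_, rfl⟩ ⟨_, rfl⟩) ⟨_, rfl⟩) ⟨_, rfl⟩))
    (fun p => (tendsto_natCast_sub hl (p.1 + p.2)).mul_const _)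
  have hlim : ∑' p : ℕ × ℕ, q ^ (2 * p.1 ^ 2 + 4 * p.1 * p.2 + 3 * p.2 ^ 2) *
      (E * summandInv q p.1 p.2) = theta q * E ^ 2 := by
    refine tendsto_nhds_unique ht (hR.congr fun M => ?_)
    rw [← sum_doubleSum_finite h h' M, ← sum_range_sum_range_eq_tsum M]
    · refine Finset.sum_congr rfl fun N _ => Finset.sum_congr rfl fun r hr => ?_
      obtain ⟨n, rfl⟩ := Nat.exists_eq_add_of_le' (Finset.mem_range_succ_iff.1 hr)
      have e1 : ((n + r : ℕ) : ℤ) - r = n := by push_cast; ring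
      have e2 : ((n + r : ℕ) : ℤ) + r = (n + 2 * r : ℕ) := by push_cast; ring
      rw [Nat.add_sub_cancel, e1, e2, summandInv]
      ring
    · intro p hp
      rw [show P2 (M - (p.1 + p.2 : ℕ)) = 0 from qPochInv_of_neg _ _ (by lia)]
      ring
  -- The factor `1 / (q²;q²)_(M-N)` of the finite identity has left an extra `E` in every term;
  -- multiplying by `L` removes it.
  have hsum := hs.hasSum.mul_left L
  rw [hlim] at hsum
  have hLE := Ring.mul_inverse_cancel _ hu
  have e1 : L * (theta q * E ^ 2) = theta q * E := by linear_combination theta q * E * hLE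
  have e2 : ∀ p : ℕ × ℕ, L * (q ^ (2 * p.1 ^ 2 + 4 * p.1 * p.2 + 3 * p.2 ^ 2) *
      (E * summandInv q p.1 p.2)) =
      q ^ (2 * p.1 ^ 2 + 4 * p.1 * p.2 + 3 * p.2 ^ 2) * summandInv q p.1 p.2 := fun p => by
    linear_combination (q ^ (2 * p.1 ^ 2 + 4 * p.1 * p.2 + 3 * p.2 ^ 2) *
      summandInv q p.1 p.2) * hLE
  simpa only [e1, e2] using hsum

lemma isUnit_summandDenom {A : Type*} [CommRing A] {q : A} (h : ∀ j : ℕ, IsUnit (1 - q * q ^ j))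
    (h' : ∀ j : ℕ, IsUnit (1 - -q * q ^ j)) (n r : ℕ) : IsUnit (summandDenom q n r) :=
  (((isUnit_qPoch h' _).mul (isUnit_qPoch h' _)).mul (isUnit_qPoch h _)).mul (isUnit_qPoch h _)

lemma summandInv_eq {A : Type*} [CommRing A] {q : A} (h : ∀ j : ℕ, IsUnit (1 - q * q ^ j))
    (h' : ∀ j : ℕ, IsUnit (1 - -q * q ^ j)) (n r : ℕ) :
    summandInv q n r = Ring.inverse (summandDenom q n r) := by
  have hu := isUnit_summandDenom h h' n r
  apply hu.mul_left_cancel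
  rw [Ring.mul_inverse_cancel _ hu, summandDenom, summandInv]
  calc _ = (qPoch q q r * qPochInv q q r) * (qPoch q q n * qPochInv q q n) *
        (qPoch (-q) q (n + r) * qPochInv (-q) q (n + r : ℕ)) *
        (qPoch (-q) q (n + 2 * r) * qPochInv (-q) q (n + 2 * r : ℕ)) := by ring
    _ = 1 := by simp only [qPoch_mul_qPochInv h, qPoch_mul_qPochInv h', one_mul]

/-- The double-sum identity in any ring in which the convergence principles hold. -/
theorem doubleSum_identity (H : QLimitPrinciples q Bdd)
    (hu : ∀ k : ℕ, IsUnit (1 - q ^ (k + 1))) (hu' : ∀ k : ℕ, IsUnit (1 + q ^ (k + 1))) :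
    (QPochConverges (q ^ 4) (q ^ 9) ∧ QPochConverges (q ^ 5) (q ^ 9) ∧
      QPochConverges (q ^ 9) (q ^ 9) ∧ QPochConverges (q ^ 2) (q ^ 2)) ∧
    (∀ n r : ℕ, IsUnit (summandDenom q n r)) ∧
    IsUnit (qPochInf (q ^ 2) (q ^ 2)) ∧
    HasSum
      (fun p : ℕ × ℕ =>
        q ^ (2 * p.1 ^ 2 + 4 * p.1 * p.2 + 3 * p.2 ^ 2) * Ring.inverse (summandDenom q p.1 p.2))
      (qPochInf₃ (q ^ 4) (q ^ 5) (q ^ 9) (q ^ 9) *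
        Ring.inverse (qPochInf (q ^ 2) (q ^ 2))) := by
  have h : ∀ j : ℕ, IsUnit (1 - q * q ^ j) := fun j => by simpa only [pow_succ'] using hu j
  have h' : ∀ j : ℕ, IsUnit (1 - -q * q ^ j) := fun j => by
    convert hu' j using 1
    ring
  have h9 : ∀ j : ℕ, IsUnit (1 - q ^ 9 * (q ^ 9) ^ j) := fun j => by
    convert hu (9 * j + 8) using 1
    ring
  refine ⟨⟨H.qPochConverges _ 8, H.qPochConverges _ 8, H.qPochConverges _ 8,
    H.qPochConverges _ 1⟩, isUnit_summandDenom h h',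
    (H.qPochInf_mul_inverse (k := 1) (isUnit_one_sub_sq h h')).1, ?_⟩
  rw [← H.theta_eq h9]
  simpa only [summandInv_eq h h'] using H.hasSum_doubleSum h h'

end QLimitPrinciples

/-! ### The two settings: complex numbers and formal power series -/

lemma qLimitPrinciples_complex {q : ℂ} (hq : ‖q‖ < 1) :
    QLimitPrinciples q (Bornology.IsBounded : Set ℂ → Prop) where
  mono h hT := hT.subset h
  union hS hT := hS.union hT
  mul hS hT := by
    obtain ⟨C, hC⟩ := hS.exists_norm_le
    obtain ⟨D, hD⟩ := hT.exists_norm_le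
    refine isBounded_iff_forall_norm_le.2 ⟨C * D, ?_⟩
    rintro _ ⟨a, ha, b, hb, rfl⟩
    rw [norm_mul]
    exact mul_le_mul (hC a ha) (hD b hb) (norm_nonneg _) ((norm_nonneg _).trans (hC a ha))
  of_tendsto h := Metric.isBounded_range_of_tendsto _ h
  of_tendsto_inverse h := by
    simp only [Ring.inverse_eq_inv']
    exact Metric.isBounded_range_of_tendsto _ (h.inv₀ one_ne_zero)
  tendsto_pow := tendsto_pow_atTop_nhds_zero_of_norm_lt_one hq
  multipliable {u} hu := by
    obtain ⟨C, hC⟩ := hu.exists_norm_le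
    apply multipliable_one_add_of_summable
    refine ((summable_geometric_of_lt_one (norm_nonneg q) hq).mul_right C).of_nonneg_of_le
      (fun _ => norm_nonneg _) fun j => ?_
    rw [norm_mul, norm_pow]
    exact mul_le_mul_of_nonneg_left (hC _ ⟨j, rfl⟩) (by positivity)
  tannery {ι e S u v} he hS hu hv := by
    obtain ⟨C, hC⟩ := hS.exists_norm_le
    have hsum : Summable fun i => ‖q‖ ^ e i * C := (he _ (norm_nonneg q) hq).mul_right C
    constructor
    · refine Summable.of_norm_bounded hsum fun i => ?_
      rw [norm_mul, norm_pow]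
      exact mul_le_mul_of_nonneg_left
        (le_of_tendsto' (hv i).norm fun M => hC _ (hu M i)) (by positivity)
    · refine tendsto_tsum_of_dominated_convergence hsum (fun i => (hv i).const_mul _)
        (Eventually.of_forall fun M i => ?_)
      rw [norm_mul, norm_pow]
      exact mul_le_mul_of_nonneg_left (hC _ (hu M i)) (by positivity)

/-- No boundedness is needed: a term `X^e w` does not affect coefficients below degree `e`, so each
coefficient of the series is a finite sum. -/
lemma qLimitPrinciples_powerSeries (R : Type*) [CommRing R] [TopologicalSpace R]
    [DiscreteTopology R] : QLimitPrinciples (PowerSeries.X : R⟦X⟧) (fun _ => True) where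
  mono _ _ := trivial
  union _ _ := trivial
  mul _ _ := trivial
  of_tendsto _ := trivial
  of_tendsto_inverse _ := trivial
  tendsto_pow :=
    PowerSeries.WithPiTopology.isTopologicallyNilpotent_of_constantCoeff_zero (by simp)
  multipliable {u} _ := by
    apply PowerSeries.WithPiTopology.multipliable_one_add_of_tendsto_order_atTop_nhds_top
    refine ENat.tendsto_nhds_top_iff_natCast_lt.2 fun n => eventually_atTop.2 ⟨n + 1, fun m hm => ?_⟩
    refine lt_of_lt_of_le (b := (m : ℕ∞)) (by exact_mod_cast hm) (PowerSeries.nat_le_order _ _ ?_)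
    intro i hi
    rw [PowerSeries.coeff_X_pow_mul', if_neg (by lia)]
  tannery {ι e S u v} he _ hu hv := by
    have hfin : ∀ d : ℕ, {i | e i ≤ d}.Finite := by
      intro d
      -- Summability at the single point `x = 1/2` already forces only finitely many exponents to be
      -- at most `d`.
      have h1 := (he (1 / 2) (by norm_num) (by norm_num)).tendsto_cofinite_zero
      have h2 := h1.eventually (gt_mem_nhds (show (0 : ℝ) < (1 / 2) ^ d by positivity))
      refine h2.subset fun i hi => ?_
      simp only [Set.mem_ofPred_eq, Set.mem_compl_iff, not_lt] at hi ⊢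
      exact pow_le_pow_of_le_one (by norm_num) (by norm_num) hi
    have hsum : ∀ (w : ι → R⟦X⟧) (d : ℕ),
        HasSum (fun i => PowerSeries.coeff d (PowerSeries.X ^ e i * w i))
          (∑ i ∈ (hfin d).toFinset, PowerSeries.coeff d (PowerSeries.X ^ e i * w i)) := by
      intro w d
      refine hasSum_sum_of_ne_finset_zero fun i hi => ?_
      rw [PowerSeries.coeff_X_pow_mul', if_neg (by simpa using hi)]
    have hsummable : ∀ w : ι → R⟦X⟧, Summable fun i => PowerSeries.X ^ e i * w i := fun w =>
      (PowerSeries.WithPiTopology.summable_iff_summable_coeff R).2 fun d => (hsum w d).summable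
    have hcoeff : ∀ (w : ι → R⟦X⟧) (d : ℕ),
        PowerSeries.coeff d (∑' i, PowerSeries.X ^ e i * w i) =
          ∑ i ∈ (hfin d).toFinset, PowerSeries.coeff d (PowerSeries.X ^ e i * w i) := fun w d =>
      ((PowerSeries.WithPiTopology.hasSum_iff_hasSum_coeff R).1 (hsummable w).hasSum d).unique
        (hsum w d)
    refine ⟨hsummable v, (PowerSeries.WithPiTopology.tendsto_iff_coeff_tendsto R _ _ _).2 fun d => ?_⟩
    simp only [hcoeff]
    refine tendsto_finsetSum _ fun i _ => ?_
    exact (PowerSeries.WithPiTopology.continuous_coeff R d).continuousAt.tendsto.comp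
      ((hv i).const_mul _)

end Limits

/-- The double-sum identity, first for complex `q` with `|q| < 1`, then for formal power series in
the indeterminate `q = X` over any commutative ring (with the topology of coefficientwise
convergence, the coefficients being discrete). In each part: the infinite products converge, the
denominators are invertible, and the double series converges unconditionally to the quotient. -/
theorem mainTheorem1 :
    (∀ q : ℂ, ‖q‖ < 1 →
      (QPochConverges (q ^ 4) (q ^ 9) ∧ QPochConverges (q ^ 5) (q ^ 9) ∧
        QPochConverges (q ^ 9) (q ^ 9) ∧ QPochConverges (q ^ 2) (q ^ 2)) ∧
      (∀ n r : ℕ, summandDenom q n r ≠ 0) ∧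
      qPochInf (q ^ 2) (q ^ 2) ≠ 0 ∧
      HasSum
        (fun p : ℕ × ℕ =>
          q ^ (2 * p.1 ^ 2 + 4 * p.1 * p.2 + 3 * p.2 ^ 2) / summandDenom q p.1 p.2)
        (qPochInf₃ (q ^ 4) (q ^ 5) (q ^ 9) (q ^ 9) / qPochInf (q ^ 2) (q ^ 2))) ∧
    (∀ (R : Type*) [CommRing R] [TopologicalSpace R] [DiscreteTopology R] (q : R⟦X⟧),
      q = PowerSeries.X →
      (QPochConverges (q ^ 4) (q ^ 9) ∧ QPochConverges (q ^ 5) (q ^ 9) ∧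
        QPochConverges (q ^ 9) (q ^ 9) ∧ QPochConverges (q ^ 2) (q ^ 2)) ∧
      (∀ n r : ℕ, IsUnit (summandDenom q n r)) ∧
      IsUnit (qPochInf (q ^ 2) (q ^ 2)) ∧
      HasSum
        (fun p : ℕ × ℕ =>
          q ^ (2 * p.1 ^ 2 + 4 * p.1 * p.2 + 3 * p.2 ^ 2) * Ring.inverse (summandDenom q p.1 p.2))
        (qPochInf₃ (q ^ 4) (q ^ 5) (q ^ 9) (q ^ 9) *
          Ring.inverse (qPochInf (q ^ 2) (q ^ 2)))) := by
  constructor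
  · intro q hq
    -- Used with `c = -1` and `c = 1`, for the factors `1 - q^(k+1)` and `1 + q^(k+1)`.
    have hne : ∀ {c : ℂ} (k : ℕ), ‖c‖ = 1 → c + q ^ (k + 1) ≠ 0 := by
      intro c k hc h0
      have h1 : ‖q ^ (k + 1)‖ = 1 := by
        rw [← norm_neg, ← eq_neg_of_add_eq_zero_left h0, hc]
      rw [norm_pow] at h1
      exact (pow_lt_one₀ (norm_nonneg q) hq (Nat.succ_ne_zero k)).ne h1
    obtain ⟨h1, h2, h3, h4⟩ := (qLimitPrinciples_complex hq).doubleSum_identity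
      (fun k => isUnit_iff_ne_zero.2 fun h0 => hne (c := -1) k (by simp) (by
        linear_combination -h0))
      (fun k => isUnit_iff_ne_zero.2 (hne k (by simp)))
    exact ⟨h1, fun n r => (h2 n r).ne_zero, h3.ne_zero, by
      simpa only [Ring.inverse_eq_inv', ← div_eq_mul_inv] using h4⟩
  · rintro R _ _ _ q rfl
    exact (qLimitPrinciples_powerSeries R).doubleSum_identity
      (fun k => PowerSeries.isUnit_iff_constantCoeff.2 (by simp))
      (fun k => PowerSeries.isUnit_iff_constantCoeff.2 (by simp))
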